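/- Let $f:\mathbb R^d\to\mathbb R$ be twice continuously differentiable with $L$-Lipschitz gradient, $\|\nabla f(x)-\nabla f(y)\|_2\le L\|x-y\|_2$ for some $L>0$, and $m$-strongly convex for some $m>0$, i.e. $f(y)\ge f(x)+\langle\nabla f(x),y-x\rangle+\frac m2\|x-y\|_2^2$ for all $x,y$. Put $\gamma=2$ and $u=1/L$, and let $B_t$ denote standard Brownian motion in $\mathbb R^d$, independent of the initial condition of the equations below. For a probability measure $p_0$ on $\mathbb R^{2d}$ let $\Phi_t p_0$ be the law of $(x_t,v_t)$, where $(x_0,v_0)\sim p_0$ and $$dv_t=-\gamma v_t\,dt-u\nabla f(x_t)\,dt+\sqrt{2\gamma u}\,dB_t,\qquad dx_t=v_t\,dt,$$ and let $\tilde\Phi_t p_0$ be the law of $(\tilde x_t,\tilde v_t)$, where $(\tilde x_0,\tilde v_0)\sim p_0$ and the gradient is frozen at the initial position, $$d\tilde v_t=-\gamma\tilde v_t\,dt-u\nabla f(\tilde x_0)\,dt+\sqrt{2\gamma u}\,dB_t,\qquad d\tilde x_t=\tilde v_t\,dt.$$ Let $p_0$ be any probability measure on $\mathbb R^{2d}$,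 let $0\le\delta\le1$, and let $\mathcal E_K\ge0$ be such that $\mathbb E_{(x,v)\sim\Phi_t p_0}\|v\|_2^2\le\mathcal E_K$ for all $t\in[0,\delta]$. Then $$W_2(\Phi_\delta p_0,\tilde\Phi_\delta p_0)\le\delta^2\sqrt{\frac{2\mathcal E_K}{5}},$$ where $W_2(\mu,\nu)=\bigl(\inf_\zeta\int\|a-b\|_2^2\,d\zeta(a,b)\bigr)^{1/2}$, the infimum being over all probability measures $\zeta$ on $\mathbb R^{2d}\times\mathbb R^{2d}$ with marginals $\mu$ and $\nu$. -/

import Mathlib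

open MeasureTheory ProbabilityTheory
open scoped NNReal ENNReal

noncomputable section

namespace UnderdampedLangevin

/-- Positions and velocities: `ℝ^d` with the Euclidean norm. -/
abbrev Vec (d : ℕ) : Type := EuclideanSpace ℝ (Fin d)

/-- Phase space `ℝ^{2d}` of pairs (position, velocity), with the Euclidean norm
`‖(x, v)‖² = ‖x‖² + ‖v‖²`. -/
abbrev Phase (d : ℕ) : Type := WithLp 2 (Vec d × Vec d)

/-- Transference plans: measures on `X × X` with marginals `μ` and `ν`
(they are probability measures as soon as `μ` is one). -/
def transferencePlans {X : Type*} [MeasurableSpace X] (μ ν : Measure X) : Set (Measure (X × X)) :=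
  {ζ | ζ.map Prod.fst = μ ∧ ζ.map Prod.snd = ν}

/-- The Wasserstein distance of order two, with values in `[0, ∞]`. -/
def W₂ {X : Type*} [MeasurableSpace X] [PseudoEMetricSpace X] (μ ν : Measure X) : ℝ≥0∞ :=
  (⨅ ζ ∈ transferencePlans μ ν, ∫⁻ z, edist z.1 z.2 ^ 2 ∂ζ) ^ (1 / 2 : ℝ)

/-- `B` is a standard Brownian motion in `ℝ^d` under `P`: its coordinates are independent
standard real Brownian motions (started at `0`, with almost surely continuous paths). -/
structure IsBrownianMotion {d : ℕ} {Ω : Type*} [MeasurableSpace Ω]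
    (B : ℝ≥0 → Ω → Vec d) (P : Measure Ω) : Prop where
  measurable : ∀ t, Measurable (B t)
  isBrownianReal : ∀ i, IsBrownianReal (fun t ω ↦ B t ω i) P
  iIndepFun : iIndepFun (fun (i : Fin d) (ω : Ω) (t : ℝ≥0) ↦ B t ω i) P

/-- `(x, v)` solves, for all times `t ≥ 0`, the stochastic differential equation
`dv_t = -γ v_t dt - u F_t dt + √(2γu) dB_t`, `dx_t = v_t dt`, where `B` is a standard Brownian
motion in `ℝ^d` independent of the initial condition `(x_0, v_0)`. The noise is additive, so the
equation in its integral form needs no stochastic integral. -/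
structure IsKineticSolution {d : ℕ} {Ω : Type*} [MeasurableSpace Ω] (γ u : ℝ)
    (F : ℝ≥0 → Ω → Vec d) (B x v : ℝ≥0 → Ω → Vec d) (P : Measure Ω) : Prop where
  brownian : IsBrownianMotion B P
  measurable_x : ∀ t, Measurable (x t)
  measurable_v : ∀ t, Measurable (v t)
  indep : IndepFun (fun ω ↦ (x 0 ω, v 0 ω)) (fun ω t ↦ B t ω) P
  continuous_x : ∀ᵐ ω ∂P, Continuous (fun t ↦ x t ω)
  continuous_v : ∀ᵐ ω ∂P, Continuous (fun t ↦ v t ω)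
  velocity : ∀ᵐ ω ∂P, ∀ t : ℝ≥0, v t ω =
    v 0 ω - (∫ s in (0 : ℝ)..t, (γ • v s.toNNReal ω + u • F s.toNNReal ω))
      + √(2 * γ * u) • B t ω
  position : ∀ᵐ ω ∂P, ∀ t : ℝ≥0, x t ω = x 0 ω + ∫ s in (0 : ℝ)..t, v s.toNNReal ω

/-- The exact underdamped Langevin diffusion:
`dv_t = -γ v_t dt - u ∇f(x_t) dt + √(2γu) dB_t`, `dx_t = v_t dt`. -/
def IsExactSolution {d : ℕ} {Ω : Type*} [MeasurableSpace Ω] (f : Vec d → ℝ) (γ u : ℝ)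
    (B x v : ℝ≥0 → Ω → Vec d) (P : Measure Ω) : Prop :=
  IsKineticSolution γ u (fun t ω ↦ gradient f (x t ω)) B x v P

/-- The discretized diffusion, whose gradient is frozen at the initial position:
`dv_t = -γ v_t dt - u ∇f(x_0) dt + √(2γu) dB_t`, `dx_t = v_t dt`. -/
def IsFrozenSolution {d : ℕ} {Ω : Type*} [MeasurableSpace Ω] (f : Vec d → ℝ) (γ u : ℝ)
    (B x v : ℝ≥0 → Ω → Vec d) (P : Measure Ω) : Prop :=
  IsKineticSolution γ u (fun _ ω ↦ gradient f (x 0 ω)) B x v P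

/-- The law of `(x_t, v_t)` on phase space. -/
def lawAt {d : ℕ} {Ω : Type*} [MeasurableSpace Ω] (P : Measure Ω)
    (x v : ℝ≥0 → Ω → Vec d) (t : ℝ≥0) : Measure (Phase d) :=
  P.map (fun ω ↦ WithLp.toLp 2 (x t ω, v t ω))

end UnderdampedLangevin

end

/-! Synchronous coupling: drive the frozen dynamics by the Brownian path and initial condition of
the exact solution. The noise cancels, so the velocity gap `w` solves `w' = -2w - u(∇f(x_s) -
∇f(x_0))` with `w 0 = 0`. Damping only shrinks it and `uL = 1`, so the velocity gap is at most a
double time integral of the speed, and the position gap a triple one (`ae_enorm_sub_frozen_le`).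
Each time integration turns a second moment bound `c sⁿ` into `c/(n+1) tⁿ⁺²`. Starting from `K`, the
gaps are bounded by `K δ⁴/3` and `K δ⁶/15`, whose sum is at most `2K δ⁴/5` when `δ ≤ 1`.

The given frozen solution may live on another space, so its law must be that of the coupled copy.
Since the noise is additive, the frozen equation is solved pathwise by a measurable map of initial
condition and path (`ae_eq_frozenFlow`); independence and uniqueness in law of Brownian motion then
fix its law (`lawAt_frozen_eq`). -/

namespace UnderdampedLangevin

open Filter Topology Set

/-! ### Linear damped equation -/

section DampedEquation

variable {E : Type*} [NormedAddCommGroup E] [NormedSpace ℝ E] [CompleteSpace E]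

/-- The solution of `y' = h - 2 y`, `y 0 = 0`. -/
noncomputable def dampedIntegral (h : ℝ → E) (t : ℝ) : E :=
  Real.exp (-2 * t) • ∫ s in (0 : ℝ)..t, Real.exp (2 * s) • h s

lemma hasDerivAt_primitive {h : ℝ → E} (hh : Continuous h) (t : ℝ) :
    HasDerivAt (fun t ↦ ∫ s in (0 : ℝ)..t, h s) (h t) t :=
  (hh.integral_hasStrictDerivAt 0 t).hasDerivAt

lemma hasDerivAt_dampedIntegral {h : ℝ → E} (hh : Continuous h) (t : ℝ) :
    HasDerivAt (dampedIntegral h) (h t - (2 : ℝ) • dampedIntegral h t) t := by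
  have h1 : HasDerivAt (fun t : ℝ ↦ Real.exp (-2 * t)) (Real.exp (-2 * t) * (-2)) t := by
    simpa using ((hasDerivAt_id t).const_mul (-2 : ℝ)).exp
  have h2 := hasDerivAt_primitive (h := fun s ↦ Real.exp (2 * s) • h s) (by fun_prop) t
  refine (h1.smul h2).congr_deriv ?_
  rw [smul_smul, ← Real.exp_add]
  simp only [dampedIntegral, smul_smul]
  rw [show -2 * t + 2 * t = 0 by ring, Real.exp_zero, one_smul, mul_comm (Real.exp _), neg_mul,
    neg_smul, ← sub_eq_add_neg]

lemma continuous_dampedIntegral {h : ℝ → E} (hh : Continuous h) :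
    Continuous (dampedIntegral h) :=
  continuous_iff_continuousAt.2 fun t ↦ (hasDerivAt_dampedIntegral hh t).continuousAt

lemma dampedIntegral_eq_integral {h : ℝ → E} (hh : Continuous h) (t : ℝ) :
    dampedIntegral h t = ∫ s in (0 : ℝ)..t, (h s - (2 : ℝ) • dampedIntegral h s) := by
  have hc := continuous_dampedIntegral hh
  rw [intervalIntegral.integral_eq_sub_of_hasDerivAt
    (fun s _ ↦ hasDerivAt_dampedIntegral hh s) (Continuous.intervalIntegrable (by fun_prop) _ _)]
  simp [dampedIntegral]

/-- Uniqueness of the solution of `y' = h - 2 y`, `y 0 = 0` on `[0, ∞)`. -/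
lemma eq_dampedIntegral {h y : ℝ → E} (hh : Continuous h) (hy : Continuous y)
    (heq : ∀ t, 0 ≤ t → y t = ∫ s in (0 : ℝ)..t, (h s - (2 : ℝ) • y s)) {t : ℝ} (ht : 0 ≤ t) :
    y t = dampedIntegral h t := by
  -- The integral replaces `y`, whose equation is known only for `t ≥ 0`, so that a two-sided
  -- derivative exists even at `0`.
  set D : ℝ → E := fun t ↦ (∫ s in (0 : ℝ)..t, (h s - (2 : ℝ) • y s)) - dampedIntegral h t with hD
  have hD' (t : ℝ) (ht : 0 ≤ t) : HasDerivAt D (-(2 : ℝ) • D t) t := by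
    refine ((hasDerivAt_primitive (by fun_prop) t).sub
      (hasDerivAt_dampedIntegral hh t)).congr_deriv ?_
    simp only [hD]
    rw [← heq t ht]
    module
  have hφ (t : ℝ) (ht : 0 ≤ t) : HasDerivAt (fun t ↦ Real.exp (2 * t) • D t) 0 t := by
    have h1 : HasDerivAt (fun t : ℝ ↦ Real.exp (2 * t)) (Real.exp (2 * t) * 2) t := by
      simpa using ((hasDerivAt_id t).const_mul (2 : ℝ)).exp
    refine (h1.smul (hD' t ht)).congr_deriv ?_
    module
  have hconst := constant_of_has_deriv_right_zero (f := fun t ↦ Real.exp (2 * t) • D t)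
    (a := 0) (b := t) (fun s hs ↦ (hφ s hs.1).continuousAt.continuousWithinAt)
    (fun s hs ↦ (hφ s hs.1).hasDerivWithinAt) t ⟨ht, le_rfl⟩
  have h0 : D 0 = 0 := by simp [hD, dampedIntegral]
  simp only [h0, smul_zero, smul_eq_zero, Real.exp_ne_zero, false_or] at hconst
  rw [heq t ht]
  exact sub_eq_zero.1 hconst

omit [CompleteSpace E] in
lemma enorm_intervalIntegral_le {h : ℝ → E} {t : ℝ} (ht : 0 ≤ t) :
    ‖∫ s in (0 : ℝ)..t, h s‖ₑ ≤ ∫⁻ s in Ioc 0 t, ‖h s‖ₑ := by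
  rw [intervalIntegral.integral_of_le ht]
  exact enorm_integral_le_lintegral_enorm _

omit [CompleteSpace E] in
-- The kernel `exp (-2(t - s))` is at most `1` for `s ≤ t`.
lemma enorm_dampedIntegral_le {h : ℝ → E} {t : ℝ} (ht : 0 ≤ t) :
    ‖dampedIntegral h t‖ₑ ≤ ∫⁻ s in Ioc 0 t, ‖h s‖ₑ := by
  rw [dampedIntegral, ← intervalIntegral.integral_smul]
  refine (enorm_intervalIntegral_le ht).trans (setLIntegral_mono' measurableSet_Ioc fun s hs ↦ ?_)
  rw [smul_smul, ← Real.exp_add, enorm_smul]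
  refine mul_le_of_le_one_left' ?_
  rw [Real.enorm_eq_ofReal (Real.exp_nonneg _), ENNReal.ofReal_le_one, Real.exp_le_one_iff]
  linarith [hs.2]

end DampedEquation

/-! ### Jointly measurable evaluation of paths -/

section Regularization

variable {E : Type*} [NormedAddCommGroup E] [CompleteSpace E] [MeasurableSpace E] [BorelSpace E]
  [SecondCountableTopology E]

/-- A jointly measurable functional that evaluates a path at a time, if the path is continuous. -/
noncomputable def pathEval (s : ℝ) (b : ℝ≥0 → E) : E :=
  limUnder atTop fun n : ℕ ↦ b (⌊s.toNNReal * n⌋₊ / n)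

omit [CompleteSpace E] [MeasurableSpace E] [BorelSpace E] [SecondCountableTopology E] in
lemma pathEval_of_continuous {b : ℝ≥0 → E} (hb : Continuous b) (s : ℝ) :
    pathEval s b = b s.toNNReal := by
  refine Tendsto.limUnder_eq ((hb.tendsto _).comp ?_)
  rw [← NNReal.tendsto_coe]
  have := (tendsto_nat_floor_mul_div_atTop (R := ℝ) (s.toNNReal).coe_nonneg).comp
    tendsto_natCast_atTop_atTop
  refine this.congr fun n ↦ ?_
  simp only [Function.comp_apply, NNReal.coe_div, NNReal.coe_natCast]
  congr 2

/-- Evaluation is not in general jointly measurable for the product σ-algebra on all paths. Each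
approximant reads the path only at countably many grid times, so it is, and measurability passes to
the limit. -/
lemma measurable_pathEval :
    Measurable fun q : ℝ × (ℝ≥0 → E) ↦ pathEval q.1 q.2 := by
  refine (StronglyMeasurable.limUnder (l := atTop)
    (f := fun (n : ℕ) (q : ℝ × (ℝ≥0 → E)) ↦ q.2 (⌊q.1.toNNReal * n⌋₊ / n))
    fun n ↦ Measurable.stronglyMeasurable ?_).measurable
  have h1 : Measurable fun r : ℕ × (ℝ≥0 → E) ↦ r.2 (r.1 / n) :=
    measurable_from_prod_countable_right fun k ↦ measurable_pi_apply (k / n : ℝ≥0)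
  exact h1.comp (f := fun q : ℝ × (ℝ≥0 → E) ↦ (⌊q.1.toNNReal * n⌋₊, q.2))
    (by fun_prop)

end Regularization

/-! ### Second moments of iterated time integrals -/

section Cumulative

variable {Ω : Type*} [MeasurableSpace Ω]

/-- The running integral in time of a nonnegative process. -/
noncomputable def runningIntegral (g : ℝ → Ω → ℝ≥0∞) (t : ℝ) (ω : Ω) : ℝ≥0∞ :=
  ∫⁻ s in Ioc 0 t, g s ω

lemma measurable_runningIntegral {g : ℝ → Ω → ℝ≥0∞} (hg : Measurable (Function.uncurry g)) :
    Measurable (Function.uncurry (runningIntegral g)) := by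
  have h1 : MeasurableSet {q : (ℝ × Ω) × ℝ | q.2 ∈ Ioc 0 q.1.1} :=
    (measurableSet_lt measurable_const measurable_snd).inter
      (measurableSet_le measurable_snd (measurable_fst.comp measurable_fst))
  have h2 : Measurable fun q : (ℝ × Ω) × ℝ ↦ g q.2 q.1.2 :=
    hg.comp (f := fun q : (ℝ × Ω) × ℝ ↦ (q.2, q.1.2)) (by fun_prop)
  convert (h2.indicator h1).lintegral_prod_right' (ν := volume) using 1
  ext q
  simp only [Function.uncurry, runningIntegral]
  rw [← lintegral_indicator measurableSet_Ioc]
  rfl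

lemma sq_lintegral_le_measure_mul {α : Type*} [MeasurableSpace α] (μ : Measure α)
    {g : α → ℝ≥0∞} (hg : AEMeasurable g μ) :
    (∫⁻ a, g a ∂μ) ^ 2 ≤ μ univ * ∫⁻ a, g a ^ 2 ∂μ := by
  have h := ENNReal.lintegral_mul_le_Lp_mul_Lq μ Real.HolderConjugate.two_two
    (f := fun _ ↦ 1) aemeasurable_const hg
  simp only [Pi.mul_apply, one_mul, ENNReal.one_rpow, lintegral_const] at h
  calc (∫⁻ a, g a ∂μ) ^ 2
      ≤ (μ univ ^ (1 / 2 : ℝ) * (∫⁻ a, g a ^ (2 : ℝ) ∂μ) ^ (1 / 2 : ℝ)) ^ 2 := by gcongr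
    _ = μ univ * ∫⁻ a, g a ^ 2 ∂μ := by
      rw [mul_pow, ← ENNReal.rpow_natCast, ← ENNReal.rpow_natCast, ← ENNReal.rpow_mul,
        ← ENNReal.rpow_mul]
      simp

/-- Cauchy–Schwarz in time costs the factor `t`; Tonelli then moves the expectation inside. -/
lemma lintegral_sq_runningIntegral_le {P : Measure Ω} [SFinite P] {g : ℝ → Ω → ℝ≥0∞}
    (hg : Measurable (Function.uncurry g)) {C : ℝ → ℝ≥0∞} {t : ℝ}
    (hC : ∀ s ∈ Ioc 0 t, ∫⁻ ω, g s ω ^ 2 ∂P ≤ C s) :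
    ∫⁻ ω, runningIntegral g t ω ^ 2 ∂P ≤ ENNReal.ofReal t * ∫⁻ s in Ioc 0 t, C s := by
  calc ∫⁻ ω, runningIntegral g t ω ^ 2 ∂P
      ≤ ∫⁻ ω, (ENNReal.ofReal t * ∫⁻ s in Ioc 0 t, g s ω ^ 2) ∂P := by
        refine lintegral_mono fun ω ↦ ?_
        have := sq_lintegral_le_measure_mul (volume.restrict (Ioc 0 t)) (g := fun s ↦ g s ω)
          (hg.comp (f := fun s ↦ (s, ω)) (by fun_prop)).aemeasurable
        simpa [runningIntegral] using this
    _ = ENNReal.ofReal t * ∫⁻ s in Ioc 0 t, ∫⁻ ω, g s ω ^ 2 ∂P := by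
        rw [lintegral_const_mul' _ _ ENNReal.ofReal_ne_top, lintegral_lintegral_swap]
        exact ((hg.comp measurable_swap).pow_const 2).aemeasurable
    _ ≤ ENNReal.ofReal t * ∫⁻ s in Ioc 0 t, C s := by
        exact mul_le_mul_right (setLIntegral_mono' measurableSet_Ioc hC) _

lemma lintegral_Ioc_mul_pow {c t : ℝ} (hc : 0 ≤ c) (ht : 0 ≤ t) (n : ℕ) :
    ∫⁻ s in Ioc 0 t, ENNReal.ofReal (c * s ^ n) = ENNReal.ofReal (c * t ^ (n + 1) / (n + 1)) := by
  rw [← ofReal_integral_eq_lintegral_ofReal, ← intervalIntegral.integral_of_le ht,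
    intervalIntegral.integral_const_mul, integral_pow]
  · simp [mul_div_assoc]
  · exact (Continuous.integrableOn_Icc (by fun_prop)).mono_set Ioc_subset_Icc_self
  · filter_upwards [ae_restrict_mem measurableSet_Ioc] with s hs
    have := hs.1.le
    positivity

/-- A moment bound of order `c sⁿ` improves by two powers of time under time integration. -/
lemma lintegral_sq_runningIntegral_le_pow {P : Measure Ω} [SFinite P] {g : ℝ → Ω → ℝ≥0∞}
    (hg : Measurable (Function.uncurry g)) {c t : ℝ} (hc : 0 ≤ c) (ht : 0 ≤ t) {n : ℕ}
    (hC : ∀ s ∈ Ioc 0 t, ∫⁻ ω, g s ω ^ 2 ∂P ≤ ENNReal.ofReal (c * s ^ n)) :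
    ∫⁻ ω, runningIntegral g t ω ^ 2 ∂P ≤ ENNReal.ofReal (c / (n + 1) * t ^ (n + 2)) := by
  refine (lintegral_sq_runningIntegral_le hg hC).trans_eq ?_
  rw [lintegral_Ioc_mul_pow hc ht, ← ENNReal.ofReal_mul ht]
  congr 1
  ring

end Cumulative

/-! ### Law of the Brownian path -/

variable {d : ℕ} {Ω Ω' : Type*} [MeasurableSpace Ω] [MeasurableSpace Ω']
  {P : Measure Ω} {P' : Measure Ω'}

lemma IsBrownianMotion.measurable_path {B : ℝ≥0 → Ω → Vec d} (hB : IsBrownianMotion B P) :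
    Measurable fun ω t ↦ B t ω :=
  measurable_pi_lambda _ hB.measurable

lemma IsBrownianMotion.ae_continuous {B : ℝ≥0 → Ω → Vec d} (hB : IsBrownianMotion B P) :
    ∀ᵐ ω ∂P, Continuous fun t ↦ B t ω := by
  filter_upwards [ae_all_iff.2 fun i ↦ (hB.isBrownianReal i).cont] with ω hω
  exact (PiLp.continuous_toLp 2 _).comp (continuous_pi hω)

/-- Both path laws are projective limits of the same finite-dimensional laws, and such a limit is
unique. -/
lemma map_path_eq_of_isBrownianReal {X : ℝ≥0 → Ω → ℝ} {X' : ℝ≥0 → Ω' → ℝ}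
    (hX : IsBrownianReal X P) (hX' : IsBrownianReal X' P')
    (hm : ∀ t, Measurable (X t)) (hm' : ∀ t, Measurable (X' t)) :
    P.map (fun ω t ↦ X t ω) = P'.map (fun ω t ↦ X' t ω) := by
  have h := isProjectiveLimit_map (P := P) (X := X) (measurable_pi_lambda _ hm).aemeasurable
  have h' := isProjectiveLimit_map (P := P') (X := X') (measurable_pi_lambda _ hm').aemeasurable
  simp_rw [(hX.hasLaw _).map_eq] at h
  simp_rw [(hX'.hasLaw _).map_eq] at h'
  exact h.unique h'

/-- Uniqueness in law of Brownian motion. -/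
lemma IsBrownianMotion.map_path_eq {B : ℝ≥0 → Ω → Vec d} {B' : ℝ≥0 → Ω' → Vec d}
    (hB : IsBrownianMotion B P) (hB' : IsBrownianMotion B' P') :
    P.map (fun ω t ↦ B t ω) = P'.map (fun ω t ↦ B' t ω) := by
  have hm (i : Fin d) (t : ℝ≥0) : Measurable fun ω ↦ B t ω i :=
    (measurable_pi_apply i).comp ((WithLp.measurable_ofLp 2 _).comp (hB.measurable t))
  have hm' (i : Fin d) (t : ℝ≥0) : Measurable fun ω ↦ B' t ω i :=
    (measurable_pi_apply i).comp ((WithLp.measurable_ofLp 2 _).comp (hB'.measurable t))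
  -- Independent coordinates make the joint law a product of scalar path laws.
  have hcoord : P.map (fun ω (i : Fin d) (t : ℝ≥0) ↦ B t ω i) =
      P'.map (fun ω (i : Fin d) (t : ℝ≥0) ↦ B' t ω i) := by
    rw [hB.iIndepFun.map_fun_eq_infinitePi_map fun i ↦ measurable_pi_lambda _ (hm i),
      hB'.iIndepFun.map_fun_eq_infinitePi_map fun i ↦ measurable_pi_lambda _ (hm' i)]
    congr 1
    ext1 i
    exact map_path_eq_of_isBrownianReal (hB.isBrownianReal i) (hB'.isBrownianReal i) (hm i) (hm' i)
  let T : (Fin d → ℝ≥0 → ℝ) → ℝ≥0 → Vec d := fun p t ↦ WithLp.toLp 2 fun i ↦ p i t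
  have hT : Measurable T :=
    measurable_pi_lambda _ fun t ↦ (WithLp.measurable_toLp 2 _).comp
      (measurable_pi_lambda _ fun i ↦ (measurable_pi_apply t).comp (measurable_pi_apply i))
  have hc : Measurable fun ω (i : Fin d) (t : ℝ≥0) ↦ B t ω i :=
    measurable_pi_lambda _ fun i ↦ measurable_pi_lambda _ (hm i)
  have hc' : Measurable fun ω (i : Fin d) (t : ℝ≥0) ↦ B' t ω i :=
    measurable_pi_lambda _ fun i ↦ measurable_pi_lambda _ (hm' i)
  calc P.map (fun ω t ↦ B t ω)
      = (P.map fun ω (i : Fin d) (t : ℝ≥0) ↦ B t ω i).map T := (Measure.map_map hT hc).symm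
    _ = (P'.map fun ω (i : Fin d) (t : ℝ≥0) ↦ B' t ω i).map T := by rw [hcoord]
    _ = P'.map (fun ω t ↦ B' t ω) := Measure.map_map hT hc'

/-! ### Pathwise solution of the frozen dynamics -/

/-- The forcing of the position equation once the velocity is eliminated and the force is
frozen at the initial position. -/
noncomputable def frozenForcing (F : Vec d → Vec d) (u σ : ℝ) (z : Vec d × Vec d)
    (b : ℝ≥0 → Vec d) (s : ℝ) : Vec d :=
  z.2 - (u * s) • F z.1 + σ • pathEval s b

/-- The displacement at time `t` of the frozen dynamics. -/
noncomputable def frozenDisplacement (F : Vec d → Vec d) (u σ t : ℝ) (z : Vec d × Vec d)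
    (b : ℝ≥0 → Vec d) : Vec d :=
  dampedIntegral (frozenForcing F u σ z b) t

/-- The velocity at time `t` of the frozen dynamics. -/
noncomputable def frozenVelocity (F : Vec d → Vec d) (u σ t : ℝ) (z : Vec d × Vec d)
    (b : ℝ≥0 → Vec d) : Vec d :=
  frozenForcing F u σ z b t - (2 : ℝ) • frozenDisplacement F u σ t z b

/-- The state at time `t` of the frozen dynamics, as a function of the initial condition and of
the driving path. -/
noncomputable def frozenFlow (F : Vec d → Vec d) (u σ t : ℝ)
    (q : (Vec d × Vec d) × (ℝ≥0 → Vec d)) : Phase d :=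
  WithLp.toLp 2 (q.1.1 + frozenDisplacement F u σ t q.1 q.2, frozenVelocity F u σ t q.1 q.2)

lemma measurable_frozenForcing {F : Vec d → Vec d} (hF : Measurable F) (u σ : ℝ) :
    Measurable fun r : ((Vec d × Vec d) × (ℝ≥0 → Vec d)) × ℝ ↦
      frozenForcing F u σ r.1.1 r.1.2 r.2 := by
  have h := measurable_pathEval (E := Vec d).comp
    (f := fun r : ((Vec d × Vec d) × (ℝ≥0 → Vec d)) × ℝ ↦ (r.2, r.1.2)) (by fun_prop)
  simp only [Function.comp_def] at h
  unfold frozenForcing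
  fun_prop

lemma measurable_frozenFlow {F : Vec d → Vec d} (hF : Measurable F) (u σ : ℝ) {t : ℝ}
    (ht : 0 ≤ t) : Measurable (frozenFlow F u σ t) := by
  have hforce := measurable_frozenForcing hF u σ
  have hdisp : Measurable fun q : (Vec d × Vec d) × (ℝ≥0 → Vec d) ↦
      frozenDisplacement F u σ t q.1 q.2 := by
    simp only [frozenDisplacement, dampedIntegral, intervalIntegral.integral_of_le ht]
    have hint := (StronglyMeasurable.integral_prod_right (ν := volume.restrict (Ioc 0 t))
      (f := fun (q : (Vec d × Vec d) × (ℝ≥0 → Vec d)) (s : ℝ) ↦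
        Real.exp (2 * s) • frozenForcing F u σ q.1 q.2 s)
      (Measurable.stronglyMeasurable (by unfold Function.uncurry; fun_prop))).measurable
    exact hint.const_smul (Real.exp (-2 * t))
  have hforce' : Measurable fun q : (Vec d × Vec d) × (ℝ≥0 → Vec d) ↦
      frozenForcing F u σ q.1 q.2 t := by
    exact hforce.comp (f := fun q ↦ (q, t)) (by fun_prop)
  unfold frozenFlow frozenVelocity
  exact (WithLp.measurable_toLp 2 _).comp (by fun_prop)

lemma continuous_frozenForcing (F : Vec d → Vec d) (u σ : ℝ) (z : Vec d × Vec d)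
    {b : ℝ≥0 → Vec d} (hb : Continuous b) : Continuous (frozenForcing F u σ z b) := by
  have : frozenForcing F u σ z b = fun s ↦ z.2 - (u * s) • F z.1 + σ • b s.toNNReal := by
    ext1 s
    rw [frozenForcing, pathEval_of_continuous hb]
  rw [this]
  fun_prop

lemma frozenDisplacement_eq_integral (F : Vec d → Vec d) (u σ : ℝ) (z : Vec d × Vec d)
    {b : ℝ≥0 → Vec d} (hb : Continuous b) (t : ℝ) :
    frozenDisplacement F u σ t z b = ∫ s in (0 : ℝ)..t, frozenVelocity F u σ s z b :=
  dampedIntegral_eq_integral (continuous_frozenForcing F u σ z hb) t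

lemma continuous_frozenVelocity (F : Vec d → Vec d) (u σ : ℝ) (z : Vec d × Vec d)
    {b : ℝ≥0 → Vec d} (hb : Continuous b) : Continuous fun s ↦ frozenVelocity F u σ s z b := by
  have h := continuous_frozenForcing F u σ z hb
  exact h.sub ((continuous_dampedIntegral h).const_smul (2 : ℝ))

/-- The frozen dynamics is given by the frozen flow. -/
lemma ae_eq_frozenFlow {F : Vec d → Vec d} {u : ℝ} {B x v : ℝ≥0 → Ω → Vec d}
    (h : IsKineticSolution 2 u (fun _ ω ↦ F (x 0 ω)) B x v P) (t : ℝ≥0) :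
    (fun ω ↦ (WithLp.toLp 2 (x t ω, v t ω) : Phase d)) =ᵐ[P]
      fun ω ↦ frozenFlow F u (√(2 * 2 * u)) t ((x 0 ω, v 0 ω), fun t ↦ B t ω) := by
  filter_upwards [h.brownian.ae_continuous, h.continuous_x, h.continuous_v, h.velocity,
    h.position] with ω hB hx hv hvel hpos
  set σ := √(2 * 2 * u)
  set z := (x 0 ω, v 0 ω) with hz
  have hforce := continuous_frozenForcing F u σ z hB
  have hvc : Continuous fun s : ℝ ↦ v s.toNNReal ω := hv.comp continuous_real_toNNReal
  have hxc : Continuous fun s : ℝ ↦ x s.toNNReal ω := hx.comp continuous_real_toNNReal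
  -- As `∫ v = x - x₀`, the velocity equation becomes `v = h - 2(x - x₀)`, so the displacement
  -- solves the damped equation with forcing `h`.
  have hvel' (t : ℝ) (ht : 0 ≤ t) : v t.toNNReal ω =
      frozenForcing F u σ z (fun t ↦ B t ω) t - (2 : ℝ) • (x t.toNNReal ω - x 0 ω) := by
    rw [hvel, hpos t.toNNReal, intervalIntegral.integral_add
      (Continuous.intervalIntegrable (by fun_prop) _ _) (by simp),
      intervalIntegral.integral_smul, intervalIntegral.integral_const, frozenForcing,
      pathEval_of_continuous hB, Real.coe_toNNReal _ ht]
    module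
  have hdisp (t : ℝ) (ht : 0 ≤ t) :
      x t.toNNReal ω - x 0 ω = frozenDisplacement F u σ t z fun t ↦ B t ω := by
    refine eq_dampedIntegral (y := fun t ↦ x t.toNNReal ω - x 0 ω) hforce (by fun_prop)
      (fun t ht ↦ ?_) ht
    rw [hpos, add_sub_cancel_left, Real.coe_toNNReal _ ht]
    refine intervalIntegral.integral_congr fun s hs ↦ ?_
    rw [uIcc_of_le ht] at hs
    exact hvel' s hs.1
  have h1 := hdisp t t.2
  have h2 := hvel' t t.2
  simp only [Real.toNNReal_coe] at h1 h2
  rw [frozenFlow, frozenVelocity, ← h1, h2, hz, add_sub_cancel]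

/-- The law of the frozen dynamics is determined by the initial law. -/
lemma lawAt_frozen_eq [IsProbabilityMeasure P] {F : Vec d → Vec d} (hF : Measurable F) {u : ℝ}
    {B x v : ℝ≥0 → Ω → Vec d}
    (h : IsKineticSolution 2 u (fun _ ω ↦ F (x 0 ω)) B x v P) (t : ℝ≥0) :
    lawAt P x v t = (((P.map fun ω ↦ (x 0 ω, v 0 ω)).prod
      (P.map fun ω t ↦ B t ω)).map (frozenFlow F u (√(2 * 2 * u)) t)) := by
  have h0 : Measurable fun ω ↦ (x 0 ω, v 0 ω) := (h.measurable_x 0).prodMk (h.measurable_v 0)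
  have hB := h.brownian.measurable_path
  rw [lawAt, Measure.map_congr (ae_eq_frozenFlow h t),
    ← (indepFun_iff_map_prod_eq_prod_map_map h0.aemeasurable hB.aemeasurable).1 h.indep,
    Measure.map_map (measurable_frozenFlow hF _ _ t.coe_nonneg) (h0.prodMk hB)]
  rfl

/-! ### Pathwise comparison of exact and frozen dynamics -/

/-- A jointly measurable version of the speed `‖v_s‖` of a process with continuous paths. -/
noncomputable def speed (v : ℝ≥0 → Ω → Vec d) (s : ℝ) (ω : Ω) : ℝ≥0∞ :=
  ‖pathEval s fun t ↦ v t ω‖ₑ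

lemma measurable_speed {v : ℝ≥0 → Ω → Vec d} (hv : ∀ t, Measurable (v t)) :
    Measurable (Function.uncurry (speed v)) := by
  have h := measurable_pathEval (E := Vec d).comp
    (f := fun r : ℝ × Ω ↦ (r.1, fun t ↦ v t r.2))
    (measurable_fst.prodMk (measurable_pi_lambda _ fun t ↦ (hv t).comp measurable_snd))
  exact h.enorm

/-- Synchronous coupling: the exact and the frozen dynamics, driven by the same Brownian path from
the same initial condition, differ by iterated time integrals of the speed. -/
lemma ae_enorm_sub_frozen_le {F : Vec d → Vec d} (hFc : Continuous F) {u : ℝ}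
    (hF : ∀ y z, ‖u • (F y - F z)‖ₑ ≤ ‖y - z‖ₑ) {B x v : ℝ≥0 → Ω → Vec d}
    (h : IsKineticSolution 2 u (fun t ω ↦ F (x t ω)) B x v P) (t : ℝ≥0) :
    ∀ᵐ ω ∂P,
      ‖v t ω - frozenVelocity F u (√(2 * 2 * u)) t (x 0 ω, v 0 ω) fun t ↦ B t ω‖ₑ
          ≤ runningIntegral (runningIntegral (speed v)) t ω ∧
      ‖x t ω - (x 0 ω + frozenDisplacement F u (√(2 * 2 * u)) t (x 0 ω, v 0 ω) fun t ↦ B t ω)‖ₑ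
          ≤ runningIntegral (runningIntegral (runningIntegral (speed v))) t ω := by
  filter_upwards [h.brownian.ae_continuous, h.continuous_x, h.continuous_v, h.velocity,
    h.position] with ω hB hx hv hvel hpos
  set σ := √(2 * 2 * u)
  set z := (x 0 ω, v 0 ω) with hz
  set V : ℝ → Vec d := fun s ↦ frozenVelocity F u σ s z fun t ↦ B t ω with hV
  have hVc : Continuous V := continuous_frozenVelocity F u σ z hB
  have hvc : Continuous fun s : ℝ ↦ v s.toNNReal ω := hv.comp continuous_real_toNNReal
  have hxc : Continuous fun s : ℝ ↦ x s.toNNReal ω := hx.comp continuous_real_toNNReal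
  have hFx : Continuous fun s : ℝ ↦ F (x s.toNNReal ω) := hFc.comp hxc
  have hdisp (s : ℝ) : frozenDisplacement F u σ s z (fun t ↦ B t ω) = ∫ r in (0 : ℝ)..s, V r :=
    frozenDisplacement_eq_integral F u σ z hB s
  set g : ℝ → Vec d := fun s ↦ -(u • (F (x s.toNNReal ω) - F (x 0 ω))) with hg
  have hgc : Continuous g := by fun_prop
  -- Initial velocity and noise cancel in the difference; only the gradient increment `g` remains as
  -- forcing.
  have hw (s : ℝ) (hs : 0 ≤ s) : v s.toNNReal ω - V s = dampedIntegral g s := by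
    refine eq_dampedIntegral (y := fun s ↦ v s.toNNReal ω - V s) hgc (by fun_prop)
      (fun s hs ↦ ?_) hs
    have hint {k : ℝ → Vec d} (hk : Continuous k) : IntervalIntegrable k volume 0 s :=
      hk.intervalIntegrable _ _
    have e1 : V s = v 0 ω - (u * s) • F (x 0 ω) + σ • B s.toNNReal ω -
        (2 : ℝ) • ∫ r in (0 : ℝ)..s, V r := by
      rw [← hdisp]
      simp only [hV, frozenVelocity, frozenForcing, pathEval_of_continuous hB, hz]
    have e2 : ∫ r in (0 : ℝ)..s, (g r - (2 : ℝ) • (v r.toNNReal ω - V r)) =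
        (2 : ℝ) • (∫ r in (0 : ℝ)..s, V r) + (u * s) • F (x 0 ω) -
          ∫ r in (0 : ℝ)..s, ((2 : ℝ) • v r.toNNReal ω + u • F (x r.toNNReal ω)) := by
      have e3 : (u * s) • F (x 0 ω) = ∫ _ in (0 : ℝ)..s, u • F (x 0 ω) := by
        rw [intervalIntegral.integral_const, smul_smul, sub_zero, mul_comm]
      rw [e3, ← intervalIntegral.integral_smul,
        ← intervalIntegral.integral_add (hint (by fun_prop)) (hint (by fun_prop)),
        ← intervalIntegral.integral_sub (hint (by fun_prop)) (hint (by fun_prop))]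
      refine intervalIntegral.integral_congr fun r _ ↦ ?_
      simp only [hg]
      module
    rw [e2, e1, hvel, Real.coe_toNNReal _ hs]
    module
  have hx0 (s : ℝ) (hs : 0 ≤ s) :
      ‖x s.toNNReal ω - x 0 ω‖ₑ ≤ runningIntegral (speed v) s ω := by
    rw [hpos, add_sub_cancel_left, Real.coe_toNNReal _ hs]
    refine (enorm_intervalIntegral_le hs).trans_eq ?_
    simp only [runningIntegral, speed, pathEval_of_continuous hv]
  have hw' (s : ℝ) (hs : 0 ≤ s) :
      ‖v s.toNNReal ω - V s‖ₑ ≤ runningIntegral (runningIntegral (speed v)) s ω := by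
    rw [hw s hs]
    refine (enorm_dampedIntegral_le hs).trans
      (setLIntegral_mono' measurableSet_Ioc fun r hr ↦ ?_)
    rw [hg, enorm_neg]
    exact (hF _ _).trans (hx0 r hr.1.le)
  refine ⟨by simpa using hw' t t.2, ?_⟩
  have : x t ω - (x 0 ω + frozenDisplacement F u σ t z fun t ↦ B t ω) =
      ∫ s in (0 : ℝ)..t, (v s.toNNReal ω - V s) := by
    rw [hdisp, hpos, intervalIntegral.integral_sub (hvc.intervalIntegrable _ _)
      (hVc.intervalIntegrable _ _)]
    abel
  rw [this]
  exact (enorm_intervalIntegral_le t.2).trans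
    (setLIntegral_mono' measurableSet_Ioc fun r hr ↦ hw' r hr.1.le)

lemma lintegral_speed_sq {B x v F : ℝ≥0 → Ω → Vec d} {γ u : ℝ}
    (h : IsKineticSolution γ u F B x v P) (s : ℝ) :
    ∫⁻ ω, speed v s ω ^ 2 ∂P = ∫⁻ z, ‖z.snd‖ₑ ^ 2 ∂(lawAt P x v s.toNNReal) := by
  have hm : Measurable fun ω ↦ (WithLp.toLp 2 (x s.toNNReal ω, v s.toNNReal ω) : Phase d) :=
    (WithLp.measurable_toLp 2 _).comp ((h.measurable_x _).prodMk (h.measurable_v _))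
  have hsnd : Measurable fun z : Phase d ↦ ‖z.snd‖ₑ ^ 2 :=
    ((measurable_snd.comp (WithLp.measurable_ofLp 2 (Vec d × Vec d))).enorm).pow_const 2
  rw [lawAt, lintegral_map hsnd hm]
  refine lintegral_congr_ae ?_
  filter_upwards [h.continuous_v] with ω hv
  simp only [speed, pathEval_of_continuous hv]
  rfl

/-! ### Coupling bound on the Wasserstein distance -/

lemma W₂_le_of_coupling {Ω X : Type*} [MeasurableSpace Ω] [MeasurableSpace X]
    [PseudoEMetricSpace X] {P : Measure Ω} {μ ν : Measure X} {a b : Ω → X} (ha : Measurable a)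
    (hb : Measurable b) (hμ : P.map a = μ) (hν : P.map b = ν) :
    W₂ μ ν ≤ (∫⁻ ω, edist (a ω) (b ω) ^ 2 ∂P) ^ (1 / 2 : ℝ) := by
  have hmem : P.map (fun ω ↦ (a ω, b ω)) ∈ transferencePlans μ ν := by
    constructor
    · rw [Measure.map_map measurable_fst (ha.prodMk hb)]
      exact hμ
    · rw [Measure.map_map measurable_snd (ha.prodMk hb)]
      exact hν
  unfold W₂
  gcongr
  -- The one-sided `lintegral_map_le` needs no measurability of the distance.
  exact (iInf₂_le _ hmem).trans
    (lintegral_map_le (fun z : X × X ↦ edist z.1 z.2 ^ 2) fun ω ↦ (a ω, b ω))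

lemma edist_sq_eq (a b : Phase d) :
    edist a b ^ 2 = ‖a.fst - b.fst‖ₑ ^ 2 + ‖a.snd - b.snd‖ₑ ^ 2 := by
  rw [WithLp.prod_edist_eq_of_L2, ← ENNReal.rpow_natCast, ← ENNReal.rpow_mul,
    edist_eq_enorm_sub, edist_eq_enorm_sub]
  simp

/-- Second moment bound for the synchronous coupling. -/
lemma lintegral_edist_frozenFlow_sq_le [IsProbabilityMeasure P] {F : Vec d → Vec d}
    (hFc : Continuous F) {u : ℝ} (hF : ∀ y z, ‖u • (F y - F z)‖ₑ ≤ ‖y - z‖ₑ)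
    {B x v : ℝ≥0 → Ω → Vec d} (h : IsKineticSolution 2 u (fun t ω ↦ F (x t ω)) B x v P)
    {δ : ℝ≥0} (hδ : δ ≤ 1) {K : ℝ} (hK : 0 ≤ K)
    (hbound : ∀ t ≤ δ, ∫⁻ z, ‖z.snd‖ₑ ^ 2 ∂(lawAt P x v t) ≤ ENNReal.ofReal K) :
    ∫⁻ ω, edist (WithLp.toLp 2 (x δ ω, v δ ω) : Phase d)
        (frozenFlow F u (√(2 * 2 * u)) δ ((x 0 ω, v 0 ω), fun t ↦ B t ω)) ^ 2 ∂P
      ≤ ENNReal.ofReal (δ ^ 4 * (2 * K / 5)) := by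
  have hs := measurable_speed h.measurable_v
  have hs1 := measurable_runningIntegral hs
  have hs2 := measurable_runningIntegral hs1
  have b0 (s : ℝ) (hs : s ∈ Ioc (0 : ℝ) δ) :
      ∫⁻ ω, speed v s ω ^ 2 ∂P ≤ ENNReal.ofReal (K * s ^ 0) := by
    rw [lintegral_speed_sq h, pow_zero, mul_one]
    exact hbound _ (Real.toNNReal_le_iff_le_coe.2 hs.2)
  have b1 (t : ℝ) (ht : t ∈ Ioc (0 : ℝ) δ) :
      ∫⁻ ω, runningIntegral (speed v) t ω ^ 2 ∂P ≤ ENNReal.ofReal (K * t ^ 2) := by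
    simpa using lintegral_sq_runningIntegral_le_pow hs hK ht.1.le
      fun s hs ↦ b0 s ⟨hs.1, hs.2.trans ht.2⟩
  have b2 (t : ℝ) (ht0 : 0 ≤ t) (ht : t ≤ δ) :
      ∫⁻ ω, runningIntegral (runningIntegral (speed v)) t ω ^ 2 ∂P
        ≤ ENNReal.ofReal (K / 3 * t ^ 4) := by
    refine (lintegral_sq_runningIntegral_le_pow hs1 hK ht0
      fun s hs ↦ b1 s ⟨hs.1, hs.2.trans ht⟩).trans_eq ?_
    norm_num
  have b3 : ∫⁻ ω, runningIntegral (runningIntegral (runningIntegral (speed v))) δ ω ^ 2 ∂P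
        ≤ ENNReal.ofReal (K / 15 * δ ^ 6) := by
    refine (lintegral_sq_runningIntegral_le_pow hs2 (c := K / 3) (by positivity) δ.coe_nonneg
      fun s hs ↦ b2 s hs.1.le hs.2).trans_eq ?_
    congr 1
    push_cast
    ring
  calc ∫⁻ ω, edist (WithLp.toLp 2 (x δ ω, v δ ω) : Phase d)
        (frozenFlow F u (√(2 * 2 * u)) δ ((x 0 ω, v 0 ω), fun t ↦ B t ω)) ^ 2 ∂P
      ≤ ∫⁻ ω, (runningIntegral (runningIntegral (runningIntegral (speed v))) δ ω ^ 2
          + runningIntegral (runningIntegral (speed v)) δ ω ^ 2) ∂P := by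
        refine lintegral_mono_ae ?_
        filter_upwards [ae_enorm_sub_frozen_le hFc hF h δ] with ω hω
        rw [edist_sq_eq]
        exact add_le_add (pow_le_pow_left' hω.2 2) (pow_le_pow_left' hω.1 2)
    _ = ∫⁻ ω, runningIntegral (runningIntegral (runningIntegral (speed v))) δ ω ^ 2 ∂P
          + ∫⁻ ω, runningIntegral (runningIntegral (speed v)) δ ω ^ 2 ∂P :=
        lintegral_add_right _
          ((hs2.comp (f := fun ω ↦ ((δ : ℝ), ω)) (by fun_prop)).pow_const 2)
    _ ≤ ENNReal.ofReal (K / 15 * δ ^ 6) + ENNReal.ofReal (K / 3 * δ ^ 4) :=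
        add_le_add b3 (b2 δ δ.2 le_rfl)
    _ = ENNReal.ofReal (K / 15 * δ ^ 6 + K / 3 * δ ^ 4) :=
        (ENNReal.ofReal_add (by positivity) (by positivity)).symm
    _ ≤ ENNReal.ofReal (δ ^ 4 * (2 * K / 5)) := by
        refine ENNReal.ofReal_le_ofReal ?_
        -- With `δ⁶ ≤ δ⁴`, the constant is `1/15 + 1/3 = 2/5`.
        have : (δ : ℝ) ^ 6 ≤ (δ : ℝ) ^ 4 :=
          pow_le_pow_of_le_one δ.2 (by exact_mod_cast hδ) (by norm_num)
        nlinarith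

lemma map_initial_eq {x v : ℝ≥0 → Ω → Vec d} (hx : Measurable (x 0)) (hv : Measurable (v 0)) :
    P.map (fun ω ↦ (x 0 ω, v 0 ω)) = (lawAt P x v 0).map WithLp.ofLp := by
  have hm : Measurable fun ω ↦ (WithLp.toLp 2 (x 0 ω, v 0 ω) : Phase d) :=
    (WithLp.measurable_toLp 2 _).comp (hx.prodMk hv)
  exact (Measure.map_map (WithLp.measurable_ofLp 2 (Vec d × Vec d)) hm).symm

end UnderdampedLangevin

/-- `lawAt P x v t` is `Φ_t p₀` and `lawAt P' x' v' t` is `Φ̃_t p₀`; the two solutions are arbitrary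
and may live on different probability spaces. -/
theorem theorem4 {d : ℕ} (f : UnderdampedLangevin.Vec d → ℝ) (L m : ℝ) (hL : 0 < L) (hm : 0 < m)
    (hf : ContDiff ℝ 2 f)
    (hsmooth : ∀ y z, ‖gradient f y - gradient f z‖ ≤ L * ‖y - z‖)
    (hconvex : ∀ y z, f y + inner ℝ (gradient f y) (z - y) + m / 2 * ‖y - z‖ ^ 2 ≤ f z)
    (p₀ : Measure (UnderdampedLangevin.Phase d)) [IsProbabilityMeasure p₀]
    (δ : ℝ≥0) (hδ : δ ≤ 1)
    {Ω : Type*} [MeasurableSpace Ω] (P : Measure Ω) [IsProbabilityMeasure P]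
    (B x v : ℝ≥0 → Ω → UnderdampedLangevin.Vec d)
    (hexact : UnderdampedLangevin.IsExactSolution f 2 (1 / L) B x v P)
    (hinit : UnderdampedLangevin.lawAt P x v 0 = p₀)
    {Ω' : Type*} [MeasurableSpace Ω'] (P' : Measure Ω') [IsProbabilityMeasure P']
    (B' x' v' : ℝ≥0 → Ω' → UnderdampedLangevin.Vec d)
    (hfrozen : UnderdampedLangevin.IsFrozenSolution f 2 (1 / L) B' x' v' P')
    (hinit' : UnderdampedLangevin.lawAt P' x' v' 0 = p₀)
    (E_K : ℝ) (hE_nonneg : 0 ≤ E_K)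
    (hE : ∀ t ≤ δ, ∫⁻ z, ‖z.snd‖ₑ ^ 2 ∂(UnderdampedLangevin.lawAt P x v t) ≤ ENNReal.ofReal E_K) :
    UnderdampedLangevin.W₂ (UnderdampedLangevin.lawAt P x v δ)
        (UnderdampedLangevin.lawAt P' x' v' δ)
      ≤ ENNReal.ofReal ((δ : ℝ) ^ 2 * √(2 * E_K / 5)) := by
  have hL0 : L ≠ 0 := hL.ne'
  have hFc : Continuous (gradient f) :=
    (LipschitzWith.of_dist_le_mul (K := ⟨L, hL.le⟩) fun y z ↦ by
      rw [dist_eq_norm, dist_eq_norm]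
      exact hsmooth y z).continuous
  have hF (y z : UnderdampedLangevin.Vec d) :
      ‖(1 / L) • (gradient f y - gradient f z)‖ₑ ≤ ‖y - z‖ₑ := by
    rw [enorm_le_iff_norm_le, norm_smul, Real.norm_of_nonneg (by positivity)]
    calc 1 / L * ‖gradient f y - gradient f z‖ ≤ 1 / L * (L * ‖y - z‖) := by
          gcongr
          exact hsmooth y z
      _ = ‖y - z‖ := by field_simp
  have h0 : Measurable fun ω ↦ (x 0 ω, v 0 ω) :=
    (hexact.measurable_x 0).prodMk (hexact.measurable_v 0)
  have hB := hexact.brownian.measurable_path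
  have hflow := UnderdampedLangevin.measurable_frozenFlow hFc.measurable (1 / L)
    (√(2 * 2 * (1 / L))) δ.coe_nonneg
  -- The frozen flow run on the exact solution's data has the law of the given frozen solution, so
  -- both marginals of the coupling live on `Ω`.
  have hlaw : P.map (fun ω ↦ UnderdampedLangevin.frozenFlow (gradient f) (1 / L)
      (√(2 * 2 * (1 / L))) δ ((x 0 ω, v 0 ω), fun t ↦ B t ω)) =
      UnderdampedLangevin.lawAt P' x' v' δ := by
    rw [UnderdampedLangevin.lawAt_frozen_eq hFc.measurable hfrozen δ,
      UnderdampedLangevin.map_initial_eq (hfrozen.measurable_x 0) (hfrozen.measurable_v 0),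
      hinit', ← hinit,
      ← UnderdampedLangevin.map_initial_eq (hexact.measurable_x 0) (hexact.measurable_v 0),
      ← hexact.brownian.map_path_eq hfrozen.brownian,
      ← (indepFun_iff_map_prod_eq_prod_map_map h0.aemeasurable hB.aemeasurable).1 hexact.indep,
      Measure.map_map hflow (h0.prodMk hB)]
    rfl
  refine (UnderdampedLangevin.W₂_le_of_coupling
    ((WithLp.measurable_toLp 2 _).comp
      ((hexact.measurable_x δ).prodMk (hexact.measurable_v δ)))
    (hflow.comp (h0.prodMk hB)) rfl hlaw).trans ?_
  refine (ENNReal.rpow_le_rpow (UnderdampedLangevin.lintegral_edist_frozenFlow_sq_le hFc hF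
    hexact hδ hE_nonneg hE) (by norm_num)).trans_eq ?_
  rw [ENNReal.ofReal_rpow_of_nonneg (by positivity) (by norm_num), ← Real.sqrt_eq_rpow,
    Real.sqrt_mul (by positivity), show (δ : ℝ) ^ 4 = ((δ : ℝ) ^ 2) ^ 2 by ring,
    Real.sqrt_sq (by positivity)]
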